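/- Let $\mu>-\tfrac12$, let $J_\mu$ be the Bessel function of the first kind of order $\mu$, and put $c_\mu=2^{\mu}\Gamma(\mu+1)$, $r(x)=x^{-\mu-\frac12}$, $s(x)=x^{2\mu+1}/c_\mu$ for $x>0$. Let $L^1(sr)$ be the space of measurable $f:(0,\infty)\to\mathbb C$ with $\int_0^\infty |f(x)|\,s(x)r(x)\,dx<\infty$. The Hankel transform is $$h_\mu f(t)=\int_0^\infty \sqrt{ty}\,J_\mu(ty)\,f(y)\,dy,\qquad t>0,$$ and the Hankel convolution is $$(f\sharp g)(x)=\int_0^\infty\!\int_0^\infty D_\mu(x,y,z)\,f(y)\,g(z)\,dy\,dz,\qquad x>0,$$ where $$D_\mu(x,y,z)=\frac{2^{\mu-1}(xyz)^{-\mu+\frac12}}{\Gamma(\mu+\frac12)\sqrt\pi}\,A(x,y,z)^{2\mu-1}\quad\text{if } |x-y|<z<x+y,$$ $D_\mu(x,y,z)=0$ otherwise, and $A(x,y,z)=\frac14\sqrt{[(x+y)^2-z^2][z^2-(x-y)^2]}$ is the area of the triangle with sides $x,y,z$. Let $f,g\in L^1(sr)$. Then the double integral defining $(f\sharp g)(x)$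 converges absolutely for almost every $x>0$, $f\sharp g\in L^1(sr)$, the integrals defining $h_\mu f(t)$, $h_\mu g(t)$ and $h_\mu(f\sharp g)(t)$ converge absolutely for every $t>0$, and $$h_\mu(f\sharp g)(t)=r(t)\,h_\mu f(t)\,h_\mu g(t)\qquad\text{for every } t>0.$$ -/

import Mathlib

namespace HankelConv

noncomputable section

/-- The Bessel function of the first kind `J_μ(x)` for `x > 0`, by its defining power series
`∑ (-1)^k / (k! Γ(k + μ + 1)) (x/2)^(2k + μ)`, which converges absolutely. -/
def besselJ (μ x : ℝ) : ℝ :=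
  ∑' k : ℕ, (-1 : ℝ) ^ k / ((k.factorial : ℝ) * Real.Gamma ((k : ℝ) + μ + 1)) *
    (x / 2) ^ (2 * (k : ℝ) + μ)

/-- The constant `c_μ = 2^μ Γ(μ + 1)`. -/
def c (μ : ℝ) : ℝ := (2 : ℝ) ^ μ * Real.Gamma (μ + 1)

/-- The weight `r(x) = x^(-μ - 1/2)`. -/
def r (μ x : ℝ) : ℝ := x ^ (-μ - 1 / 2)

/-- The weight `s(x) = x^(2μ + 1) / c_μ`. -/
def s (μ x : ℝ) : ℝ := x ^ (2 * μ + 1) / c μ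

/-- Membership in `L¹((0, ∞), w dx)`: `f` is (a.e. strongly) measurable on `(0, ∞)` and
`∫₀^∞ |f(x)| w(x) dx < ∞`. Values of `f` outside `(0, ∞)` play no role. -/
def MemL1 (w : ℝ → ℝ) (f : ℝ → ℂ) : Prop :=
  MeasureTheory.AEStronglyMeasurable f (MeasureTheory.volume.restrict (Set.Ioi 0)) ∧
    MeasureTheory.IntegrableOn (fun x => ‖f x‖ * w x) (Set.Ioi 0)

/-- The integrand `√(xy) J_μ(xy) f(y)` of the Hankel transform of `f` at `x`. -/
def hankelIntegrand (μ : ℝ) (f : ℝ → ℂ) (x y : ℝ) : ℂ :=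
  ((Real.sqrt (x * y) * besselJ μ (x * y) : ℝ) : ℂ) * f y

/-- The Hankel transform `h_μ f(x) = ∫₀^∞ √(xy) J_μ(xy) f(y) dy`. -/
def hankel (μ : ℝ) (f : ℝ → ℂ) (x : ℝ) : ℂ :=
  ∫ y in Set.Ioi (0 : ℝ), hankelIntegrand μ f x y

/-- The area of the triangle with sides `x, y, z`. -/
def area (x y z : ℝ) : ℝ :=
  1 / 4 * Real.sqrt (((x + y) ^ 2 - z ^ 2) * (z ^ 2 - (x - y) ^ 2))

open scoped Classical in
/-- The kernel `D_μ(x, y, z)` of the Hankel convolution. -/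
def D (μ x y z : ℝ) : ℝ :=
  if |x - y| < z ∧ z < x + y then
    (2 : ℝ) ^ (μ - 1) * (x * y * z) ^ (-μ + 1 / 2) /
      (Real.Gamma (μ + 1 / 2) * Real.sqrt Real.pi) * area x y z ^ (2 * μ - 1)
  else 0

/-- The integrand `D_μ(x, y, z) f(y) g(z)` of the Hankel convolution at `x`. -/
def convIntegrand (μ : ℝ) (f g : ℝ → ℂ) (x y z : ℝ) : ℂ :=
  (D μ x y z : ℂ) * f y * g z

/-- The Hankel convolution `(f ♯ g)(x) = ∫₀^∞ ∫₀^∞ D_μ(x, y, z) f(y) g(z) dy dz`. -/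
def conv (μ : ℝ) (f g : ℝ → ℂ) (x : ℝ) : ℂ :=
  ∫ z in Set.Ioi (0 : ℝ), ∫ y in Set.Ioi (0 : ℝ), convIntegrand μ f g x y z

end

end HankelConv

namespace HankelConv

open Finset Polynomial

/-! ### Finite hypergeometric identities behind the product formula. -/

section Combinatorics

/-! Write `W = s·r` and let `j(v)` be `normalizedBessel μ v`, so that `√(ty) J_μ(ty) = t^(μ+1/2)
j((ty)²) W(y)`. Up to the factor `t^(μ+1/2)`, the Hankel transform of `f` integrates `W f` against
`j((t·)²)`, and the theorem says that `D` linearizes products of these functions.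

For fixed `y, z`, substitute the cosine `u` of the triangle's angle between `y` and `z`, so `x² = y²
+ z² - 2yzu`. Then `W(x) D(x,y,z) dx` becomes `W(y) W(z)` times the normalized Gegenbauer weight
`(1-u²)^(μ-1/2) du` (`s_mul_r_mul_D_eq`). Linearization is thereby Gegenbauer's product formula
(`integral_normalizedBessel_mul_gegenbauerWeight`). It is proved by comparing power series: the
moments of the weight are explicit, and the resulting finite sums match the Cauchy product by
Chu–Vandermonde.

Poisson's integral gives `|j| ≤ 1` at squares, and the total mass of the kernel is `W(y) W(z)`.
Hence all integrands are jointly integrable, Fubini applies, and the transform of the convolution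
factors. -/

theorem ascPochhammer_succ_eval_left (n : ℕ) (a : ℝ) :
    (ascPochhammer ℝ (n + 1)).eval a = a * (ascPochhammer ℝ n).eval (a + 1) := by
  simp [ascPochhammer_succ_left, eval_comp]

theorem Gamma_add_nat_eq {a : ℝ} (ha : 0 < a) (k : ℕ) :
    Real.Gamma (a + k) = (ascPochhammer ℝ k).eval a * Real.Gamma a := by
  induction k with
  | zero => simp
  | succ k ih =>
    have : a + ((k + 1 : ℕ) : ℝ) = (a + k) + 1 := by push_cast; ring
    rw [this, Real.Gamma_add_one (by positivity), ih, ascPochhammer_succ_eval]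
    ring

theorem ascPochhammer_eval_add (a : ℝ) (m n : ℕ) :
    (ascPochhammer ℝ (m + n)).eval a =
      (ascPochhammer ℝ m).eval a * (ascPochhammer ℝ n).eval (a + m) := by
  rw [← ascPochhammer_mul]
  simp [eval_comp]

/-- The Chu–Vandermonde identity for `₂F₁(-m, -n; a; 1)`. -/
theorem sum_choose_mul_descFactorial_div_ascPochhammer (m : ℕ) :
    ∀ (a : ℝ), 0 < a → ∀ n : ℕ,
      ∑ i ∈ range (m + 1), (m.choose i : ℝ) * n.descFactorial i / (ascPochhammer ℝ i).eval a =
        (ascPochhammer ℝ n).eval (a + m) / (ascPochhammer ℝ n).eval a := by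
  induction m with
  | zero =>
    intro a ha n
    simp [(ascPochhammer_pos n a ha).ne']
  | succ m ih =>
    intro a ha n
    -- Pascal's rule splits the sum in two; the second half is again a sum of the same shape, with
    -- `a + 1` for `a` and `n - 1` for `n`, so the induction must quantify over both.
    have pascal : ∑ i ∈ range (m + 1 + 1),
          ((m + 1).choose i : ℝ) * n.descFactorial i / (ascPochhammer ℝ i).eval a =
        (∑ i ∈ range (m + 1), (m.choose i : ℝ) * n.descFactorial i / (ascPochhammer ℝ i).eval a) +
        ∑ i ∈ range (m + 1), (m.choose i : ℝ) * n.descFactorial (i + 1) /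
          (ascPochhammer ℝ (i + 1)).eval a := by
      have e : ∑ i ∈ range (m + 1),
            (m.choose i : ℝ) * n.descFactorial i / (ascPochhammer ℝ i).eval a =
          ∑ i ∈ range (m + 1 + 1),
            (m.choose i : ℝ) * n.descFactorial i / (ascPochhammer ℝ i).eval a := by
        rw [sum_range_succ _ (m + 1)]
        simp
      rw [e, sum_range_succ' _ (m + 1), sum_range_succ' _ (m + 1), add_right_comm,
        ← sum_add_distrib]
      congr 1
      · refine sum_congr rfl fun i _ => ?_
        rw [Nat.choose_succ_succ]
        push_cast
        ring
      · simp
    rw [pascal, ih a ha n]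
    cases n with
    | zero => simp
    | succ n =>
      have e : ∑ i ∈ range (m + 1), (m.choose i : ℝ) * (n + 1).descFactorial (i + 1) /
            (ascPochhammer ℝ (i + 1)).eval a =
          (n + 1) / a * ∑ i ∈ range (m + 1),
            (m.choose i : ℝ) * n.descFactorial i / (ascPochhammer ℝ i).eval (a + 1) := by
        rw [mul_sum]
        refine sum_congr rfl fun i _ => ?_
        have := (ascPochhammer_pos i (a + 1) (by positivity)).ne'
        rw [Nat.succ_descFactorial_succ, ascPochhammer_succ_eval_left]
        push_cast
        field_simp
      rw [e, ih (a + 1) (by positivity) n, ascPochhammer_succ_eval_left n (a + m),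
        ascPochhammer_succ_eval_left n a, ascPochhammer_succ_eval n (a + (m + 1 : ℕ))]
      have := (ascPochhammer_pos n (a + 1) (by positivity)).ne'
      push_cast
      rw [show a + 1 + (m : ℝ) = a + m + 1 by ring, show a + ((m : ℝ) + 1) = a + m + 1 by ring]
      field_simp
      ring

/-- Chu–Vandermonde in a form symmetric in `m` and `n`. The range depends only on `m + n` (the extra
terms vanish), so this sum can be exchanged with one over an antidiagonal. -/
theorem sum_descFactorial_mul_descFactorial {a : ℝ} (ha : 0 < a) (m n : ℕ) :
    ∑ i ∈ range (m + n + 1), (m.descFactorial i : ℝ) * n.descFactorial i /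
        (i.factorial * (ascPochhammer ℝ i).eval a) =
      (ascPochhammer ℝ (m + n)).eval a /
        ((ascPochhammer ℝ m).eval a * (ascPochhammer ℝ n).eval a) := by
  have h := sum_choose_mul_descFactorial_div_ascPochhammer m a ha n
  have hm := (ascPochhammer_pos m a ha).ne'
  have hn := (ascPochhammer_pos n a ha).ne'
  rw [ascPochhammer_eval_add, mul_div_mul_left _ _ hm, ← h]
  symm
  rw [← sum_subset (range_subset_range.2 (show m + 1 ≤ m + n + 1 by omega))]
  · refine sum_congr rfl fun i _ => ?_
    have hi := (ascPochhammer_pos i a ha).ne'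
    rw [Nat.descFactorial_eq_factorial_mul_choose m i]
    push_cast
    field_simp
  · intro i _ hi
    have : m < i := by simpa using hi
    simp [Nat.descFactorial_eq_zero_iff_lt.2 this]

/-- Differentiating the binomial theorem `i` times in `Y` and `l` times in `Z`. -/
theorem sum_antidiagonal_choose_mul_descFactorial (Y Z : ℝ) (k i l : ℕ) :
    ∑ p ∈ antidiagonal k, (k.choose p.1 : ℝ) * p.1.descFactorial i * p.2.descFactorial l *
        Y ^ p.1 * Z ^ p.2 =
      k.descFactorial (i + l) * (Y + Z) ^ (k - (i + l)) * Y ^ i * Z ^ l := by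
  induction i generalizing k with
  | zero =>
    induction l generalizing k with
    | zero =>
      simp only [Nat.descFactorial_zero, Nat.cast_one, mul_one, add_zero, pow_zero, one_mul,
        Nat.sub_zero]
      rw [(Commute.all Y Z).add_pow']
      simp [mul_assoc]
    | succ l ih =>
      cases k with
      | zero => simp
      | succ k =>
        rw [Nat.sum_antidiagonal_succ', Nat.zero_descFactorial_succ]
        have := ih k
        have e : ∀ p ∈ antidiagonal k, ((k + 1).choose p.1 : ℝ) * p.1.descFactorial 0 *
            (p.2 + 1).descFactorial (l + 1) * Y ^ p.1 * Z ^ (p.2 + 1) =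
            (k + 1) * Z * ((k.choose p.1 : ℝ) * p.1.descFactorial 0 * p.2.descFactorial l *
              Y ^ p.1 * Z ^ p.2) := by
          intro p hp
          have hp : p.1 + p.2 = k := by simpa using hp
          have h1 := Nat.add_one_mul_choose_eq k p.2
          have h2 : (k + 1).choose (p.2 + 1) = (k + 1).choose p.1 :=
            Nat.choose_symm_of_eq_add (by omega)
          have h3 : k.choose p.2 = k.choose p.1 := Nat.choose_symm_of_eq_add (by omega)
          rw [h2, h3] at h1
          have h4 : ((k : ℝ) + 1) * k.choose p.1 = (k + 1).choose p.1 * (p.2 + 1) := by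
            exact_mod_cast h1
          rw [Nat.succ_descFactorial_succ]
          push_cast
          rw [pow_succ]
          linear_combination (-(p.1.descFactorial 0 : ℝ) * p.2.descFactorial l * Y ^ p.1 *
            Z ^ p.2 * Z) * h4
        rw [sum_congr rfl e, ← mul_sum, this, ← add_assoc 0 l 1, Nat.succ_descFactorial_succ,
          Nat.add_sub_add_right]
        push_cast
        ring
  | succ i ih =>
    cases k with
    | zero => simp [Nat.add_right_comm]
    | succ k =>
      rw [Nat.sum_antidiagonal_succ, Nat.zero_descFactorial_succ]
      have e : ∀ p ∈ antidiagonal k, ((k + 1).choose (p.1 + 1) : ℝ) *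
          (p.1 + 1).descFactorial (i + 1) * p.2.descFactorial l * Y ^ (p.1 + 1) * Z ^ p.2 =
          (k + 1) * Y * ((k.choose p.1 : ℝ) * p.1.descFactorial i * p.2.descFactorial l *
            Y ^ p.1 * Z ^ p.2) := by
        intro p _
        have h4 : ((k : ℝ) + 1) * k.choose p.1 = (k + 1).choose (p.1 + 1) * (p.1 + 1) := by
          exact_mod_cast Nat.add_one_mul_choose_eq k p.1
        rw [Nat.succ_descFactorial_succ]
        push_cast
        rw [pow_succ]
        linear_combination (-(p.1.descFactorial i : ℝ) * p.2.descFactorial l * Y ^ p.1 *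
          Z ^ p.2 * Y) * h4
      rw [sum_congr rfl e, ← mul_sum, ih k, Nat.add_right_comm i 1 l, Nat.succ_descFactorial_succ,
        Nat.add_sub_add_right]
      push_cast
      ring

/-- Expand the Pochhammer ratio on the right by Chu–Vandermonde and exchange sums: for fixed `i` the
inner sum is the binomial theorem differentiated `i` times in each variable. When `2 * i > k` the
descending factorial is zero, so the truncated exponent does no harm. -/
theorem sum_descFactorial_mul_add_pow {a : ℝ} (ha : 0 < a) (Y Z : ℝ) (k : ℕ) :
    ∑ i ∈ range (k + 1), (k.descFactorial (2 * i) : ℝ) /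
        (i.factorial * (ascPochhammer ℝ i).eval a) * (Y + Z) ^ (k - 2 * i) * (Y * Z) ^ i =
      ∑ p ∈ antidiagonal k, (k.choose p.1 : ℝ) * ((ascPochhammer ℝ k).eval a /
        ((ascPochhammer ℝ p.1).eval a * (ascPochhammer ℝ p.2).eval a)) * Y ^ p.1 * Z ^ p.2 := by
  have e : ∀ p ∈ antidiagonal k, (k.choose p.1 : ℝ) * ((ascPochhammer ℝ k).eval a /
        ((ascPochhammer ℝ p.1).eval a * (ascPochhammer ℝ p.2).eval a)) * Y ^ p.1 * Z ^ p.2 =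
      ∑ i ∈ range (k + 1), ((k.choose p.1 : ℝ) * p.1.descFactorial i * p.2.descFactorial i *
        Y ^ p.1 * Z ^ p.2) / (i.factorial * (ascPochhammer ℝ i).eval a) := by
    intro p hp
    have hp : p.1 + p.2 = k := by simpa using hp
    subst hp
    rw [← sum_descFactorial_mul_descFactorial ha, mul_sum, sum_mul, sum_mul]
    exact sum_congr rfl fun i _ => by ring
  rw [sum_congr rfl e, sum_comm]
  refine sum_congr rfl fun i _ => ?_
  rw [← sum_div, sum_antidiagonal_choose_mul_descFactorial, mul_pow, two_mul]
  ring

theorem sum_range_eq_sum_even {h : ℕ → ℝ} {k : ℕ} (hodd : ∀ i, h (2 * i + 1) = 0)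
    (hk : ∀ j, k < j → h j = 0) :
    ∑ j ∈ range (k + 1), h j = ∑ i ∈ range (k + 1), h (2 * i) := by
  have pairs : ∀ n, ∑ j ∈ range (2 * n), h j = ∑ i ∈ range n, h (2 * i) := by
    intro n
    induction n with
    | zero => simp
    | succ n ih =>
      rw [Nat.mul_succ, sum_range_succ, sum_range_succ, ih, hodd, sum_range_succ, add_zero]
  rw [← pairs]
  refine sum_subset (range_subset_range.2 (by omega)) fun j _ hj => hk j ?_
  simpa using hj

end Combinatorics

end HankelConv

namespace HankelConv

open Finset Polynomial MeasureTheory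

/-! ### Mass and moments of the Gegenbauer weight. -/

section Moments

/-- The Gegenbauer weight `(1 - u²)^(μ - 1/2)` on `(-1, 1)`. -/
noncomputable def gegenbauerWeight (μ u : ℝ) : ℝ := (1 - u ^ 2) ^ (μ - 1 / 2)

/-- The total mass `√π Γ(μ + 1/2) / Γ(μ + 1)` of the Gegenbauer weight. -/
noncomputable def gegenbauerMass (μ : ℝ) : ℝ :=
  Real.Gamma (μ + 1 / 2) * Real.sqrt Real.pi / Real.Gamma (μ + 1)

variable {μ : ℝ}

theorem gegenbauerMass_pos (hμ : -(1 / 2) < μ) : 0 < gegenbauerMass μ := by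
  have h1 := Real.Gamma_pos_of_pos (show 0 < μ + 1 / 2 by linarith)
  have h2 := Real.Gamma_pos_of_pos (show 0 < μ + 1 by linarith)
  have := Real.pi_pos
  unfold gegenbauerMass
  positivity

theorem betaIntegrand_ofReal (s : ℝ) {x : ℝ} (hx : x ∈ Set.Icc (0 : ℝ) 1) :
    (x : ℂ) ^ (((s : ℝ) : ℂ) - 1) * (1 - (x : ℂ)) ^ (((s : ℝ) : ℂ) - 1) =
      ((x ^ (s - 1) * (1 - x) ^ (s - 1) : ℝ) : ℂ) := by
  rw [Complex.ofReal_mul, Complex.ofReal_cpow hx.1, Complex.ofReal_cpow (sub_nonneg.2 hx.2)]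
  push_cast
  rfl

theorem intervalIntegrable_rpow_mul_one_sub_rpow {s : ℝ} (hs : 0 < s) :
    IntervalIntegrable (fun x : ℝ => x ^ (s - 1) * (1 - x) ^ (s - 1)) volume 0 1 := by
  have h := Complex.betaIntegral_convergent (u := s) (v := s) (by simpa) (by simpa)
  rw [intervalIntegrable_iff, Set.uIoc_of_le zero_le_one] at h ⊢
  refine (Integrable.re h).congr ?_
  filter_upwards [ae_restrict_mem measurableSet_Ioc] with x hx
  have := betaIntegrand_ofReal s (Set.Ioc_subset_Icc_self hx)
  simp only [this]
  exact Complex.ofReal_re _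

theorem integral_rpow_mul_one_sub_rpow {s : ℝ} (hs : 0 < s) :
    ∫ x in (0 : ℝ)..1, x ^ (s - 1) * (1 - x) ^ (s - 1) =
      Real.Gamma s * Real.Gamma s / Real.Gamma (s + s) := by
  have h := ProbabilityTheory.beta_eq_betaIntegralReal s s hs hs
  rw [ProbabilityTheory.beta] at h
  rw [h, Complex.betaIntegral]
  have : ∫ x in (0 : ℝ)..1, (x : ℂ) ^ ((s : ℂ) - 1) * (1 - (x : ℂ)) ^ ((s : ℂ) - 1) =
      ∫ x in (0 : ℝ)..1, ((x ^ (s - 1) * (1 - x) ^ (s - 1) : ℝ) : ℂ) := by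
    refine intervalIntegral.integral_congr fun x hx => ?_
    rw [Set.uIcc_of_le zero_le_one] at hx
    exact betaIntegrand_ofReal s hx
  rw [this, intervalIntegral.integral_ofReal, Complex.ofReal_re]

theorem gegenbauerWeight_two_mul_sub_one (μ : ℝ) {x : ℝ} (hx : x ∈ Set.Icc (0 : ℝ) 1) :
    gegenbauerWeight μ (2 * x + -1) =
      4 ^ (μ - 1 / 2) * (x ^ (μ + 1 / 2 - 1) * (1 - x) ^ (μ + 1 / 2 - 1)) := by
  have h1 := sub_nonneg.2 hx.2
  rw [gegenbauerWeight, show 1 - (2 * x + -1) ^ 2 = 4 * (x * (1 - x)) by ring,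
    Real.mul_rpow (by norm_num) (mul_nonneg hx.1 h1), Real.mul_rpow hx.1 h1]
  ring_nf

theorem intervalIntegrable_gegenbauerWeight (hμ : -(1 / 2) < μ) :
    IntervalIntegrable (gegenbauerWeight μ) volume (-1) 1 := by
  have h := (intervalIntegrable_rpow_mul_one_sub_rpow (s := μ + 1 / 2) (by linarith)).const_mul
    ((4 : ℝ) ^ (μ - 1 / 2))
  have h' : IntervalIntegrable (fun x => gegenbauerWeight μ (2 * x + -1)) volume 0 1 := by
    refine h.congr fun x hx => ?_
    rw [Set.uIoc_of_le zero_le_one] at hx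
    exact (gegenbauerWeight_two_mul_sub_one μ (Set.Ioc_subset_Icc_self hx)).symm
  have h2 := (h'.comp_mul_left (c := 1 / 2)).comp_add_right 1
  norm_num at h2
  convert h2 using 2
  ring_nf

/-- The substitution `u = 2x - 1` produces the beta integral with both parameters `μ + 1/2`;
Legendre's duplication formula simplifies its Gamma quotient. -/
theorem integral_gegenbauerWeight (hμ : -(1 / 2) < μ) :
    ∫ u in (-1 : ℝ)..1, gegenbauerWeight μ u = gegenbauerMass μ := by
  have h := intervalIntegral.integral_comp_mul_add (a := 0) (b := 1) (gegenbauerWeight μ)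
    (two_ne_zero) (-1)
  have e : ∫ x in (0 : ℝ)..1, gegenbauerWeight μ (2 * x + -1) =
      ∫ x in (0 : ℝ)..1, 4 ^ (μ - 1 / 2) * (x ^ (μ + 1 / 2 - 1) * (1 - x) ^ (μ + 1 / 2 - 1)) := by
    refine intervalIntegral.integral_congr fun x hx => ?_
    rw [Set.uIcc_of_le zero_le_one] at hx
    exact gegenbauerWeight_two_mul_sub_one μ hx
  rw [e, intervalIntegral.integral_const_mul,
    integral_rpow_mul_one_sub_rpow (show 0 < μ + 1 / 2 by linarith)] at h
  norm_num at h
  have hd := Real.Gamma_mul_Gamma_add_half (μ + 1 / 2)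
  have g1 := Real.Gamma_pos_of_pos (show 0 < μ + 1 by linarith)
  have g2 := Real.Gamma_pos_of_pos (show 0 < μ + 1 / 2 + (μ + 1 / 2) by linarith)
  have p4 : (4 : ℝ) ^ (μ - 1 / 2) * 2 * 2 ^ (1 - 2 * (μ + 1 / 2)) = 1 := by
    rw [show (4 : ℝ) = 2 ^ (2 : ℝ) by norm_num, ← Real.rpow_mul (by norm_num),
      ← Real.rpow_add_one (by norm_num), ← Real.rpow_add (by norm_num),
      show 2 * (μ - 1 / 2) + 1 + (1 - 2 * (μ + 1 / 2)) = 0 by ring, Real.rpow_zero]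
  rw [show μ + 1 / 2 + 1 / 2 = μ + 1 by ring,
    show 2 * (μ + 1 / 2) = μ + 1 / 2 + (μ + 1 / 2) by ring]
    at hd
  rw [show 2 * (μ + 1 / 2) = μ + 1 / 2 + (μ + 1 / 2) by ring] at p4
  rw [gegenbauerMass, eq_div_iff g1.ne']
  have h' : ∫ u in (-1 : ℝ)..1, gegenbauerWeight μ u = 2 * (4 ^ (μ - 1 / 2) *
      (Real.Gamma (μ + 1 / 2) * Real.Gamma (μ + 1 / 2) /
        Real.Gamma (μ + 1 / 2 + (μ + 1 / 2)))) := by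
    rw [h]; ring
  rw [h']
  generalize Real.Gamma (μ + 1 / 2 + (μ + 1 / 2)) = G at *
  generalize Real.Gamma (μ + 1 / 2) = G' at *
  generalize (4 : ℝ) ^ (μ - 1 / 2) = P at *
  field_simp
  linear_combination (2 * P * G') * hd + G' * G * √Real.pi * p4

theorem intervalIntegrable_mul_gegenbauerWeight (hμ : -(1 / 2) < μ) {q : ℝ → ℝ}
    (hq : ContinuousOn q (Set.Icc (-1) 1)) :
    IntervalIntegrable (fun u => q u * gegenbauerWeight μ u) volume (-1) 1 :=
  (intervalIntegrable_gegenbauerWeight hμ).continuousOn_mul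
    (by rwa [Set.uIcc_of_le (by norm_num)])

/-- The moments of the Gegenbauer weight. -/
noncomputable def gegenbauerMoment (μ : ℝ) (j : ℕ) : ℝ :=
  ∫ u in (-1 : ℝ)..1, u ^ j * gegenbauerWeight μ u

theorem gegenbauerMoment_odd (μ : ℝ) (i : ℕ) : gegenbauerMoment μ (2 * i + 1) = 0 := by
  have h := intervalIntegral.integral_comp_neg (a := -1) (b := 1)
    (fun u : ℝ => u ^ (2 * i + 1) * gegenbauerWeight μ u)
  have e : ∀ u : ℝ, (-u) ^ (2 * i + 1) * gegenbauerWeight μ (-u) =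
      -(u ^ (2 * i + 1) * gegenbauerWeight μ u) := by
    intro u
    simp only [gegenbauerWeight, neg_sq, Odd.neg_pow ⟨i, rfl⟩]
    ring
  simp only [e, intervalIntegral.integral_neg, neg_neg] at h
  change -gegenbauerMoment μ (2 * i + 1) = gegenbauerMoment μ (2 * i + 1) at h
  linarith

/-- Integrate the derivative of `u^(i+1) (1-u²)^(μ+1/2)`; the boundary terms vanish because `μ + 1/2
> 0`. -/
theorem gegenbauerMoment_add_two (hμ : -(1 / 2) < μ) (i : ℕ) :
    (i + 2 * μ + 2) * gegenbauerMoment μ (i + 2) = (i + 1) * gegenbauerMoment μ i := by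
  have hint : ∀ j : ℕ, IntervalIntegrable (fun u : ℝ => u ^ j * gegenbauerWeight μ u)
      volume (-1) 1 := fun j =>
    intervalIntegrable_mul_gegenbauerWeight hμ (by fun_prop)
  have hderiv : ∀ u ∈ Set.Ioo (-1 : ℝ) 1,
      HasDerivAt (fun u : ℝ => u ^ (i + 1) * (1 - u ^ 2) ^ (μ + 1 / 2))
        ((i + 1) * (u ^ i * gegenbauerWeight μ u) -
          (i + 2 * μ + 2) * (u ^ (i + 2) * gegenbauerWeight μ u)) u := by
    intro u hu
    have hpos : 0 < 1 - u ^ 2 := by nlinarith [hu.1, hu.2]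
    have h1 := hasDerivAt_pow (i + 1) u
    have h2 := ((hasDerivAt_pow 2 u).const_sub 1).rpow_const (p := μ + 1 / 2)
      (Or.inl hpos.ne')
    refine (h1.mul h2).congr_deriv ?_
    have e : (1 - u ^ 2) ^ (μ + 1 / 2) = (1 - u ^ 2) * (1 - u ^ 2) ^ (μ - 1 / 2) := by
      rw [← Real.rpow_one_add' hpos.le (by linarith)]
      ring_nf
    rw [e, gegenbauerWeight, show μ + 1 / 2 - 1 = μ - 1 / 2 by ring]
    push_cast
    ring
  have h := intervalIntegral.integral_eq_sub_of_hasDerivAt_of_le (a := -1) (b := 1) (by norm_num)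
    (by
      -- The weight may be singular at `±1`, but the primitive has the positive exponent `μ + 1/2`
      -- and is continuous up to the endpoints.
      refine ContinuousOn.mul (by fun_prop) (ContinuousOn.rpow_const (by fun_prop) ?_)
      intro u _
      right; linarith) hderiv (((hint i).const_mul _).sub ((hint (i + 2)).const_mul _))
  rw [intervalIntegral.integral_sub ((hint i).const_mul _) ((hint (i + 2)).const_mul _),
    intervalIntegral.integral_const_mul, intervalIntegral.integral_const_mul] at h
  have z : (1 - (1 : ℝ) ^ 2) ^ (μ + 1 / 2) = 0 := by
    rw [one_pow, sub_self, Real.zero_rpow (by linarith)]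
  have z' : (1 - (-1 : ℝ) ^ 2) ^ (μ + 1 / 2) = 0 := by
    rw [neg_one_sq, sub_self, Real.zero_rpow (by linarith)]
  rw [z, z'] at h
  change (i + 1) * gegenbauerMoment μ i - (i + 2 * μ + 2) * gegenbauerMoment μ (i + 2) = _ at h
  linarith

theorem gegenbauerMoment_even (hμ : -(1 / 2) < μ) (i : ℕ) :
    gegenbauerMoment μ (2 * i) = gegenbauerMass μ * ((2 * i).factorial /
      (4 ^ i * i.factorial * (ascPochhammer ℝ i).eval (μ + 1))) := by
  induction i with
  | zero => simp [gegenbauerMoment, integral_gegenbauerWeight hμ]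
  | succ i ih =>
    have h := gegenbauerMoment_add_two hμ (2 * i)
    rw [ih] at h
    have hp : 0 < μ + 1 + i := by have : (0 : ℝ) ≤ i := i.cast_nonneg; linarith
    have hp' : ((2 * i : ℕ) : ℝ) + 2 * μ + 2 = 2 * (μ + 1 + i) := by push_cast; ring
    rw [hp'] at h
    have ha := ascPochhammer_pos i (μ + 1) (by linarith)
    rw [Nat.mul_succ, Nat.factorial_succ, Nat.factorial_succ, Nat.factorial_succ,
      ascPochhammer_succ_eval]
    apply mul_left_cancel₀ (show 2 * (μ + 1 + i) ≠ 0 by positivity)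
    rw [h]
    have : ((i.factorial : ℕ) : ℝ) ≠ 0 := by positivity
    push_cast
    field_simp
    ring

/-- The mean of `(y² + z² - 2 y z u)^k` against the Gegenbauer weight. -/
theorem integral_pow_mul_gegenbauerWeight (hμ : -(1 / 2) < μ) (y z : ℝ) (k : ℕ) :
    ∫ u in (-1 : ℝ)..1, (y ^ 2 + z ^ 2 - 2 * y * z * u) ^ k * gegenbauerWeight μ u =
      gegenbauerMass μ * ∑ p ∈ antidiagonal k, (k.choose p.1 : ℝ) *
        ((ascPochhammer ℝ k).eval (μ + 1) / ((ascPochhammer ℝ p.1).eval (μ + 1) *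
          (ascPochhammer ℝ p.2).eval (μ + 1))) * (y ^ 2) ^ p.1 * (z ^ 2) ^ p.2 := by
  have hint : ∀ j : ℕ, IntervalIntegrable (fun u : ℝ => u ^ j * gegenbauerWeight μ u)
      volume (-1) 1 := fun j =>
    intervalIntegrable_mul_gegenbauerWeight hμ (by fun_prop)
  have e : ∀ u : ℝ, (y ^ 2 + z ^ 2 - 2 * y * z * u) ^ k * gegenbauerWeight μ u =
      ∑ j ∈ range (k + 1), (-(2 * y * z)) ^ j * (y ^ 2 + z ^ 2) ^ (k - j) * k.choose j *
        (u ^ j * gegenbauerWeight μ u) := by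
    intro u
    rw [show y ^ 2 + z ^ 2 - 2 * y * z * u = -(2 * y * z) * u + (y ^ 2 + z ^ 2) by ring, add_pow,
      sum_mul]
    refine sum_congr rfl fun j _ => ?_
    rw [mul_pow]
    ring
  simp_rw [e]
  rw [intervalIntegral.integral_finsetSum fun j _ => (hint j).const_mul _]
  simp_rw [intervalIntegral.integral_const_mul]
  change ∑ j ∈ range (k + 1), _ * gegenbauerMoment μ j = _
  -- Odd moments vanish by symmetry, and binomials vanish for indices beyond `k`; only even indices
  -- remain.
  rw [sum_range_eq_sum_even (fun i => by rw [gegenbauerMoment_odd, mul_zero])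
    (fun j hj => by simp [Nat.choose_eq_zero_of_lt hj]),
    ← sum_descFactorial_mul_add_pow (by linarith), mul_sum]
  refine sum_congr rfl fun i _ => ?_
  have ha := ascPochhammer_pos i (μ + 1) (by linarith)
  rw [gegenbauerMoment_even hμ, Nat.descFactorial_eq_factorial_mul_choose, pow_mul, neg_sq]
  push_cast
  rw [show (2 * y * z) ^ 2 = 4 * (y ^ 2 * z ^ 2) by ring, mul_pow 4]
  field_simp

/-- Termwise integration by dominated convergence, used both for Poisson's integral and for the
product formula. -/
theorem hasSum_integral_mul_gegenbauerWeight (hμ : -(1 / 2) < μ) {a : ℕ → ℝ} {R : ℝ}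
    (ha : Summable fun k => |a k| * R ^ k) {q : ℝ → ℝ} (hq : Continuous q)
    (hqR : ∀ u ∈ Set.Icc (-1 : ℝ) 1, |q u| ≤ R) :
    HasSum (fun k => a k * ∫ u in (-1 : ℝ)..1, q u ^ k * gegenbauerWeight μ u)
      (∫ u in (-1 : ℝ)..1, (∑' k, a k * q u ^ k) * gegenbauerWeight μ u) := by
  have hmem : ∀ u ∈ Set.uIoc (-1 : ℝ) 1, u ∈ Set.Icc (-1 : ℝ) 1 := fun u hu =>
    Set.Ioc_subset_Icc_self (by rwa [Set.uIoc_of_le (by norm_num)] at hu)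
  have hb : ∀ u ∈ Set.Icc (-1 : ℝ) 1, ∀ k, ‖a k * q u ^ k‖ ≤ |a k| * R ^ k := by
    intro u hu k
    rw [Real.norm_eq_abs, abs_mul, abs_pow]
    gcongr
    exact hqR u hu
  have hs : ∀ u ∈ Set.Icc (-1 : ℝ) 1, Summable fun k => a k * q u ^ k := fun u hu =>
    Summable.of_norm_bounded ha (hb u hu)
  have h := intervalIntegral.hasSum_integral_of_dominated_convergence (μ := volume)
    (a := -1) (b := 1)
    (F := fun k u => a k * (q u ^ k * gegenbauerWeight μ u))
    (f := fun u => (∑' k, a k * q u ^ k) * gegenbauerWeight μ u)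
    (fun k u => |a k| * R ^ k * ‖gegenbauerWeight μ u‖)
    (fun k => ((intervalIntegrable_mul_gegenbauerWeight hμ
      (q := fun u => q u ^ k) (by fun_prop)).const_mul (a k)).def'.aestronglyMeasurable)
    (fun k => Filter.Eventually.of_forall fun u hu => by
      rw [← mul_assoc, norm_mul]
      gcongr
      exact hb u (hmem u hu) k)
    (Filter.Eventually.of_forall fun u _ => ha.mul_right _)
    (by
      simp_rw [tsum_mul_right]
      exact (intervalIntegrable_gegenbauerWeight hμ).norm.const_mul _)
    (Filter.Eventually.of_forall fun u hu => by
      simp_rw [← mul_assoc]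
      exact (hs u (hmem u hu)).hasSum.mul_right _)
  simpa only [intervalIntegral.integral_const_mul] using h

end Moments

end HankelConv

namespace HankelConv

open Finset Polynomial MeasureTheory

/-! ### Power series, boundedness and product formula of the normalized Bessel function. -/

section NormalizedBessel

variable {μ : ℝ}

/-- The coefficients of the normalized Bessel function. -/
noncomputable def besselCoeff (μ : ℝ) (k : ℕ) : ℝ :=
  (-1) ^ k / (4 ^ k * k.factorial * (ascPochhammer ℝ k).eval (μ + 1))

/-- The normalized Bessel function `Γ(μ + 1) (2 / x)^μ J_μ(x)` as an entire function
of `v = x²`. -/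
noncomputable def normalizedBessel (μ v : ℝ) : ℝ := ∑' k, besselCoeff μ k * v ^ k

/-- Each new factor `4(μ + 1 + k)` exceeds `2`. This lets the Bessel coefficients be dominated by
those of the exponential series. -/
theorem one_le_four_pow_mul_ascPochhammer (hμ : -(1 / 2) < μ) (k : ℕ) :
    1 ≤ 4 ^ k * (ascPochhammer ℝ k).eval (μ + 1) := by
  induction k with
  | zero => simp
  | succ k ih =>
    rw [ascPochhammer_succ_eval]
    have hk : (0 : ℝ) ≤ k := k.cast_nonneg
    have : (4 : ℝ) ^ (k + 1) * ((ascPochhammer ℝ k).eval (μ + 1) * (μ + 1 + k)) =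
        4 ^ k * (ascPochhammer ℝ k).eval (μ + 1) * (4 * (μ + 1 + k)) := by ring
    rw [this]
    exact one_le_mul_of_one_le_of_one_le ih (by linarith)

theorem abs_besselCoeff_le (hμ : -(1 / 2) < μ) (k : ℕ) :
    |besselCoeff μ k| ≤ 1 / k.factorial := by
  have h := one_le_four_pow_mul_ascPochhammer hμ k
  have ha := ascPochhammer_pos k (μ + 1) (by linarith)
  have hk : (0 : ℝ) < k.factorial := by positivity
  rw [besselCoeff, abs_div, abs_pow, abs_neg, abs_one, one_pow, abs_of_pos (by positivity)]
  apply one_div_le_one_div_of_le hk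
  nlinarith

theorem summable_abs_besselCoeff_mul_pow (hμ : -(1 / 2) < μ) {R : ℝ} (hR : 0 ≤ R) :
    Summable fun k => |besselCoeff μ k| * R ^ k := by
  refine Summable.of_nonneg_of_le (fun k => by positivity) (fun k => ?_)
    (Real.summable_pow_div_factorial R)
  calc |besselCoeff μ k| * R ^ k ≤ 1 / k.factorial * R ^ k := by
        gcongr
        exact abs_besselCoeff_le hμ k
    _ = R ^ k / k.factorial := by ring

theorem summable_norm_besselCoeff_mul_pow (hμ : -(1 / 2) < μ) (v : ℝ) :
    Summable fun k => ‖besselCoeff μ k * v ^ k‖ := by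
  simpa [abs_mul, abs_pow] using summable_abs_besselCoeff_mul_pow hμ (abs_nonneg v)

theorem measurable_normalizedBessel (hμ : -(1 / 2) < μ) : Measurable (normalizedBessel μ) := by
  refine measurable_of_tendsto_metrizable
    (f := fun n v => ∑ k ∈ range n, besselCoeff μ k * v ^ k) (fun n => by fun_prop) ?_
  rw [tendsto_pi_nhds]
  intro v
  exact (summable_norm_besselCoeff_mul_pow hμ v).of_norm.hasSum.tendsto_sum_nat

theorem besselJ_eq (hμ : -(1 / 2) < μ) {x : ℝ} (hx : 0 < x) :
    besselJ μ x = (x / 2) ^ μ / Real.Gamma (μ + 1) * normalizedBessel μ (x ^ 2) := by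
  rw [besselJ, normalizedBessel, ← tsum_mul_left]
  refine tsum_congr fun k => ?_
  have hx2 : 0 < x / 2 := by positivity
  have hg := Real.Gamma_pos_of_pos (show 0 < μ + 1 by linarith)
  have ha := ascPochhammer_pos k (μ + 1) (by linarith)
  rw [show (k : ℝ) + μ + 1 = μ + 1 + k by ring, Gamma_add_nat_eq (by linarith), Real.rpow_add hx2,
    besselCoeff]
  have e : (x / 2) ^ (2 * (k : ℝ)) = (x ^ 2) ^ k / 4 ^ k := by
    rw [show 2 * (k : ℝ) = ((2 * k : ℕ) : ℝ) by push_cast; ring, Real.rpow_natCast, pow_mul,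
      div_pow, div_pow]
    norm_num
  rw [e]
  field_simp

/-- Poisson's integral for the normalized Bessel function. -/
theorem integral_cos_mul_gegenbauerWeight (hμ : -(1 / 2) < μ) (x : ℝ) :
    ∫ u in (-1 : ℝ)..1, Real.cos (x * u) * gegenbauerWeight μ u =
      gegenbauerMass μ * normalizedBessel μ (x ^ 2) := by
  have hsum : Summable fun k : ℕ => |(-1 : ℝ) ^ k / (2 * k).factorial| * (x ^ 2) ^ k := by
    have := (Real.hasSum_cosh x).summable
    refine this.congr fun k => ?_
    rw [abs_div, abs_pow, abs_neg, abs_one, one_pow, abs_of_pos (by positivity), pow_mul]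
    ring
  have h := hasSum_integral_mul_gegenbauerWeight hμ hsum (q := fun u => (x * u) ^ 2)
    (by fun_prop) (fun u hu => by
      rw [abs_of_nonneg (sq_nonneg _), mul_pow]
      have : u ^ 2 ≤ 1 := by nlinarith [hu.1, hu.2]
      nlinarith [sq_nonneg x])
  have e : ∀ u : ℝ, ∑' k : ℕ, (-1 : ℝ) ^ k / (2 * k).factorial * ((x * u) ^ 2) ^ k =
      Real.cos (x * u) := by
    intro u
    rw [Real.cos_eq_tsum]
    refine tsum_congr fun k => ?_
    rw [pow_mul]
    ring
  simp only [e] at h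
  rw [← h.tsum_eq, normalizedBessel, ← tsum_mul_left]
  refine tsum_congr fun k => ?_
  have e2 : ∀ u : ℝ, ((x * u) ^ 2) ^ k * gegenbauerWeight μ u =
      (x ^ 2) ^ k * (u ^ (2 * k) * gegenbauerWeight μ u) := by
    intro u
    rw [mul_pow, mul_pow, pow_mul u]
    ring
  simp_rw [e2]
  rw [intervalIntegral.integral_const_mul]
  change _ * (_ * gegenbauerMoment μ (2 * k)) = _
  have ha := ascPochhammer_pos k (μ + 1) (by linarith)
  rw [gegenbauerMoment_even hμ, besselCoeff]
  field_simp

theorem gegenbauerWeight_nonneg {u : ℝ} (hu : u ∈ Set.Icc (-1 : ℝ) 1) :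
    0 ≤ gegenbauerWeight μ u :=
  Real.rpow_nonneg (by nlinarith [hu.1, hu.2]) _

/-- Poisson's integral is an average of cosines against a positive weight. The restriction to
squares matters: at negative arguments all terms of the series are nonnegative and the function is
unbounded. -/
theorem abs_normalizedBessel_sq_le_one (hμ : -(1 / 2) < μ) (x : ℝ) :
    |normalizedBessel μ (x ^ 2)| ≤ 1 := by
  have hm := gegenbauerMass_pos hμ
  have h := intervalIntegral.norm_integral_le_of_norm_le (a := -1) (b := 1) (by norm_num)
    (f := fun u => Real.cos (x * u) * gegenbauerWeight μ u) (g := gegenbauerWeight μ)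
    (Filter.Eventually.of_forall fun u hu => by
      have hw := gegenbauerWeight_nonneg (μ := μ) (Set.Ioc_subset_Icc_self hu)
      rw [norm_mul, Real.norm_of_nonneg hw]
      exact mul_le_of_le_one_left hw (Real.abs_cos_le_one _))
    (intervalIntegrable_gegenbauerWeight hμ)
  rw [integral_cos_mul_gegenbauerWeight hμ, integral_gegenbauerWeight hμ, norm_mul,
    Real.norm_of_nonneg hm.le, Real.norm_eq_abs] at h
  nlinarith

/-- Gegenbauer's product formula for the normalized Bessel function. -/
theorem integral_normalizedBessel_mul_gegenbauerWeight (hμ : -(1 / 2) < μ) (y z : ℝ) :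
    ∫ u in (-1 : ℝ)..1,
        normalizedBessel μ (y ^ 2 + z ^ 2 - 2 * y * z * u) * gegenbauerWeight μ u =
      gegenbauerMass μ * (normalizedBessel μ (y ^ 2) * normalizedBessel μ (z ^ 2)) := by
  have h := hasSum_integral_mul_gegenbauerWeight hμ
    (summable_abs_besselCoeff_mul_pow hμ (sq_nonneg (|y| + |z|)))
    (q := fun u => y ^ 2 + z ^ 2 - 2 * y * z * u) (by fun_prop) (fun u hu => by
      have hu' : |u| ≤ 1 := abs_le.2 hu
      have hyz : |y * z * u| ≤ |y| * |z| := by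
        rw [abs_mul, abs_mul]
        exact mul_le_of_le_one_right (by positivity) hu'
      have := abs_le.1 hyz
      rw [abs_le]
      constructor <;> nlinarith [sq_abs y, sq_abs z, sq_nonneg (|y| - |z|)])
  change HasSum _ (∫ u in (-1 : ℝ)..1, normalizedBessel μ (y ^ 2 + z ^ 2 - 2 * y * z * u) *
    gegenbauerWeight μ u) at h
  rw [← h.tsum_eq, normalizedBessel, normalizedBessel,
    tsum_mul_tsum_eq_tsum_sum_antidiagonal_of_summable_norm
      (summable_norm_besselCoeff_mul_pow hμ _) (summable_norm_besselCoeff_mul_pow hμ _),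
    ← tsum_mul_left]
  refine tsum_congr fun k => ?_
  -- The factor `(a)_k` in the `k`-th mean cancels the one in `besselCoeff μ k`, leaving the `k`-th
  -- term of the Cauchy product.
  rw [integral_pow_mul_gegenbauerWeight hμ, mul_left_comm, mul_sum]
  congr 1
  refine sum_congr rfl fun p hp => ?_
  have hp : p.1 + p.2 = k := by simpa using hp
  subst hp
  have a1 := ascPochhammer_pos p.1 (μ + 1) (by linarith)
  have a2 := ascPochhammer_pos p.2 (μ + 1) (by linarith)
  have a3 := ascPochhammer_pos (p.1 + p.2) (μ + 1) (by linarith)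
  have hc : ((p.1 + p.2).choose p.1 : ℝ) * p.1.factorial * p.2.factorial =
      (p.1 + p.2).factorial := by
    rw [Nat.choose_symm_add]
    exact_mod_cast Nat.add_choose_mul_factorial_mul_factorial p.1 p.2
  have hf : ((p.1 + p.2).factorial : ℝ) ≠ 0 := by positivity
  simp only [besselCoeff]
  rw [pow_add, pow_add]
  field_simp
  linear_combination (y ^ 2) ^ p.1 * (z ^ 2) ^ p.2 * hc

end NormalizedBessel

end HankelConv

namespace HankelConv

open MeasureTheory

/-! ### The kernel `D` as the Gegenbauer weight in the angle variable. -/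

section Kernel

variable {μ : ℝ}

theorem c_pos (hμ : -(1 / 2) < μ) : 0 < c μ := by
  have := Real.Gamma_pos_of_pos (show 0 < μ + 1 by linarith)
  unfold c
  positivity

theorem s_mul_r_eq {x : ℝ} (hx : 0 < x) : s μ x * r μ x = x ^ (μ + 1 / 2) / c μ := by
  rw [s, r, div_mul_eq_mul_div, ← Real.rpow_add hx]
  ring_nf

theorem s_mul_r_pos (hμ : -(1 / 2) < μ) {x : ℝ} (hx : 0 < x) : 0 < s μ x * r μ x := by
  have := c_pos hμ
  rw [s_mul_r_eq hx]
  positivity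

theorem measurable_s_mul_r (μ : ℝ) : Measurable fun x => s μ x * r μ x := by
  unfold s r
  fun_prop

theorem measurable_D (μ : ℝ) : Measurable fun p : ℝ × ℝ × ℝ => D μ p.1 p.2.1 p.2.2 := by
  unfold D area
  refine Measurable.ite ?_ (by fun_prop) (by fun_prop)
  exact (measurableSet_lt (f := fun p : ℝ × ℝ × ℝ => |p.1 - p.2.1|) (g := fun p => p.2.2)
    (by fun_prop) (by fun_prop)).inter (measurableSet_lt (f := fun p : ℝ × ℝ × ℝ => p.2.2)
      (g := fun p => p.1 + p.2.1) (by fun_prop) (by fun_prop))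

theorem D_nonneg (hμ : -(1 / 2) < μ) {x y z : ℝ} (hx : 0 < x) (hy : 0 < y) (hz : 0 < z) :
    0 ≤ D μ x y z := by
  have := Real.Gamma_pos_of_pos (show 0 < μ + 1 / 2 by linarith)
  unfold D area
  split_ifs
  · positivity
  · exact le_rfl

/-- The cosine of the angle between the sides `y` and `z` of the triangle with sides `x, y, z`. -/
noncomputable def angleCos (y z x : ℝ) : ℝ := (y ^ 2 + z ^ 2 - x ^ 2) / (2 * y * z)

theorem image_angleCos {y z : ℝ} (hy : 0 < y) (hz : 0 < z) :
    angleCos y z '' Set.Ioo |y - z| (y + z) = Set.Ioo (-1) 1 := by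
  have hyz : 0 < 2 * y * z := by positivity
  ext u
  constructor
  · rintro ⟨x, ⟨hx1, hx2⟩, rfl⟩
    have hx : 0 < x := (abs_nonneg _).trans_lt hx1
    have h1 : (y - z) ^ 2 < x ^ 2 := by rwa [sq_lt_sq, abs_of_pos hx]
    have h2 : x ^ 2 < (y + z) ^ 2 := by gcongr
    rw [angleCos]
    constructor
    · rw [lt_div_iff₀ hyz]; linarith
    · rw [div_lt_iff₀ hyz]; linarith
  · rintro ⟨h1, h2⟩
    have h3 : (y - z) ^ 2 < y ^ 2 + z ^ 2 - 2 * y * z * u := by nlinarith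
    have h4 : y ^ 2 + z ^ 2 - 2 * y * z * u < (y + z) ^ 2 := by nlinarith
    refine ⟨√(y ^ 2 + z ^ 2 - 2 * y * z * u), ⟨?_, ?_⟩, ?_⟩
    · rw [← Real.sqrt_sq_eq_abs]
      exact Real.sqrt_lt_sqrt (sq_nonneg _) h3
    · rw [Real.sqrt_lt' (by positivity)]
      exact h4
    · rw [angleCos, Real.sq_sqrt ((sq_nonneg _).trans h3.le)]
      field_simp
      ring

theorem injOn_angleCos {y z : ℝ} (hy : 0 < y) (hz : 0 < z) :
    Set.InjOn (angleCos y z) (Set.Ioo |y - z| (y + z)) := by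
  intro a ha b hb h
  have h0 : 2 * y * z ≠ 0 := by positivity
  have h1 : a ^ 2 = b ^ 2 := by
    simp only [angleCos] at h
    have := (div_left_inj' h0).1 h
    linarith
  have ha0 : 0 ≤ a := (abs_nonneg _).trans ha.1.le
  have hb0 : 0 ≤ b := (abs_nonneg _).trans hb.1.le
  exact (pow_left_inj₀ ha0 hb0 two_ne_zero).1 h1

theorem hasDerivAt_angleCos (y z x : ℝ) :
    HasDerivAt (angleCos y z) (-(x / (y * z))) x := by
  have h := ((hasDerivAt_pow 2 x).const_sub (y ^ 2 + z ^ 2)).div_const (2 * y * z)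
  refine h.congr_deriv ?_
  rw [Nat.cast_ofNat, show 2 - 1 = 1 from rfl, pow_one, mul_assoc 2 y z, ← mul_neg,
    mul_div_mul_left _ _ two_ne_zero, neg_div]

theorem mem_triangle_iff {x y z : ℝ} :
    (|x - y| < z ∧ z < x + y) ↔ x ∈ Set.Ioo |y - z| (y + z) := by
  simp only [Set.mem_Ioo, abs_lt]
  constructor
  · rintro ⟨⟨h1, h2⟩, h3⟩
    refine ⟨⟨?_, ?_⟩, ?_⟩ <;> linarith
  · rintro ⟨⟨h1, h2⟩, h3⟩
    refine ⟨⟨?_, ?_⟩, ?_⟩ <;> linarith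

/-- The factor `x / (yz)` is the Jacobian of `x ↦ angleCos y z x`, so the weighted kernel is a
multiple of the pulled-back Gegenbauer weight. -/
theorem s_mul_r_mul_D_eq (hμ : -(1 / 2) < μ) {x y z : ℝ} (hy : 0 < y) (hz : 0 < z)
    (hx : x ∈ Set.Ioo |y - z| (y + z)) :
    s μ x * r μ x * D μ x y z = (s μ y * r μ y) * (s μ z * r μ z) / gegenbauerMass μ *
      (|-(x / (y * z))| * gegenbauerWeight μ (angleCos y z x)) := by
  have hx0 : 0 < x := (abs_nonneg _).trans_lt hx.1
  have hp : 0 < y * z := by positivity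
  have h1 : (y - z) ^ 2 < x ^ 2 := by rw [sq_lt_sq, abs_of_pos hx0]; exact hx.1
  have h2 : x ^ 2 < (y + z) ^ 2 := by gcongr; exact hx.2
  have hprod : ((x + y) ^ 2 - z ^ 2) * (z ^ 2 - (x - y) ^ 2) =
      ((y + z) ^ 2 - x ^ 2) * (x ^ 2 - (y - z) ^ 2) := by ring
  have hpos : 0 < ((y + z) ^ 2 - x ^ 2) * (x ^ 2 - (y - z) ^ 2) :=
    mul_pos (by linarith) (by linarith)
  have hA : 0 < area x y z := by
    rw [area, hprod]
    positivity
  -- The area is half of `yz` times the sine of the enclosed angle, with Heron's expression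
  -- rewritten by `hprod`.
  have hw : 1 - angleCos y z x ^ 2 = (2 * area x y z / (y * z)) ^ 2 := by
    have hs := Real.sq_sqrt hpos.le
    rw [area, hprod, angleCos]
    field_simp
    linear_combination (-16) * hs
  have hW : gegenbauerWeight μ (angleCos y z x) =
      2 ^ (2 * μ - 1) * area x y z ^ (2 * μ - 1) / (y * z) ^ (2 * μ - 1) := by
    rw [gegenbauerWeight, hw, ← Real.rpow_natCast, ← Real.rpow_mul (by positivity),
      Real.div_rpow (by positivity) hp.le, Real.mul_rpow (by norm_num) hA.le]
    push_cast
    rw [show 2 * (μ - 1 / 2) = 2 * μ - 1 by ring]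
  have hg := Real.Gamma_pos_of_pos (show 0 < μ + 1 by linarith)
  have hg' := Real.Gamma_pos_of_pos (show 0 < μ + 1 / 2 by linarith)
  have hpi := Real.pi_pos
  rw [hW, abs_neg, abs_of_pos (by positivity), s_mul_r_eq hx0, s_mul_r_eq hy, s_mul_r_eq hz, D,
    if_pos (mem_triangle_iff.2 hx), gegenbauerMass, c, mul_assoc x y z,
    Real.mul_rpow hx0.le hp.le]
  have ex : x ^ (μ + 1 / 2) * x ^ (-μ + 1 / 2) = x := by
    rw [← Real.rpow_add hx0, show μ + 1 / 2 + (-μ + 1 / 2) = 1 by ring, Real.rpow_one]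
  have ep : y ^ (μ + 1 / 2) * z ^ (μ + 1 / 2) =
      (y * z) ^ (-μ + 1 / 2) * (y * z) * (y * z) ^ (2 * μ - 1) := by
    rw [← Real.mul_rpow hy.le hz.le, ← Real.rpow_add_one hp.ne', ← Real.rpow_add hp]
    ring_nf
  have e2 : (2 : ℝ) ^ (2 * μ - 1) = 2 ^ μ * 2 ^ (μ - 1) := by
    rw [← Real.rpow_add (by norm_num)]
    ring_nf
  have hT : (0 : ℝ) < 2 ^ μ := by positivity
  have hP : (0 : ℝ) < (y * z) ^ (2 * μ - 1) := by positivity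
  rw [e2]
  calc x ^ (μ + 1 / 2) / (2 ^ μ * Real.Gamma (μ + 1)) *
        (2 ^ (μ - 1) * (x ^ (-μ + 1 / 2) * (y * z) ^ (-μ + 1 / 2)) /
          (Real.Gamma (μ + 1 / 2) * √Real.pi) * area x y z ^ (2 * μ - 1))
      = (x ^ (μ + 1 / 2) * x ^ (-μ + 1 / 2)) * (2 ^ (μ - 1) * (y * z) ^ (-μ + 1 / 2) *
          area x y z ^ (2 * μ - 1)) / (2 ^ μ * Real.Gamma (μ + 1) *
            (Real.Gamma (μ + 1 / 2) * √Real.pi)) := by ring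
    _ = ((y * z) ^ (-μ + 1 / 2) * (y * z) * (y * z) ^ (2 * μ - 1)) /
          (2 ^ μ * Real.Gamma (μ + 1)) ^ 2 /
          (Real.Gamma (μ + 1 / 2) * √Real.pi / Real.Gamma (μ + 1)) * (x / (y * z) *
          (2 ^ μ * 2 ^ (μ - 1) * area x y z ^ (2 * μ - 1) / (y * z) ^ (2 * μ - 1))) := by
        rw [ex]
        generalize (y * z) ^ (2 * μ - 1) = P at *
        generalize (2 : ℝ) ^ μ = T at *
        generalize (2 : ℝ) ^ (μ - 1) = T' at *
        generalize (y * z) ^ (-μ + 1 / 2) = Q at *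
        generalize area x y z ^ (2 * μ - 1) = B at *
        generalize Real.Gamma (μ + 1 / 2) = g' at *
        generalize Real.Gamma (μ + 1) = g at *
        field_simp
    _ = _ := by
        rw [← ep]
        ring

theorem s_mul_r_mul_D_eq_zero {x y z : ℝ} (hx : x ∉ Set.Ioo |y - z| (y + z)) :
    s μ x * r μ x * D μ x y z = 0 := by
  rw [D, if_neg (fun h => hx (mem_triangle_iff.1 h)), mul_zero]

theorem sq_add_sq_sub_angleCos {y z : ℝ} (hy : 0 < y) (hz : 0 < z) (x : ℝ) :
    y ^ 2 + z ^ 2 - 2 * y * z * angleCos y z x = x ^ 2 := by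
  rw [angleCos]
  field_simp
  ring

/-- Change of variables `u = angleCos y z x`, injective from the triangle range onto `(-1, 1)`.
Taking `G = 1` gives the mass of the kernel, and a rescaled `normalizedBessel μ` gives
linearization. -/
theorem integrableOn_and_integral_mul_D (hμ : -(1 / 2) < μ) {y z : ℝ} (hy : 0 < y) (hz : 0 < z)
    {G : ℝ → ℝ} (hG : IntervalIntegrable
      (fun u => G (y ^ 2 + z ^ 2 - 2 * y * z * u) * gegenbauerWeight μ u) volume (-1) 1) :
    IntegrableOn (fun x => G (x ^ 2) * (s μ x * r μ x * D μ x y z)) (Set.Ioi 0) ∧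
    ∫ x in Set.Ioi (0 : ℝ), G (x ^ 2) * (s μ x * r μ x * D μ x y z) =
      (s μ y * r μ y) * (s μ z * r μ z) / gegenbauerMass μ *
        ∫ u in (-1 : ℝ)..1, G (y ^ 2 + z ^ 2 - 2 * y * z * u) * gegenbauerWeight μ u := by
  have hsub : Set.Ioo |y - z| (y + z) ⊆ Set.Ioi 0 := fun x hx => (abs_nonneg _).trans_lt hx.1
  have hzero : ∀ x ∈ Set.Ioi (0 : ℝ) \ Set.Ioo |y - z| (y + z),
      G (x ^ 2) * (s μ x * r μ x * D μ x y z) = 0 := fun x hx => by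
    rw [s_mul_r_mul_D_eq_zero hx.2, mul_zero]
  set K := (s μ y * r μ y) * (s μ z * r μ z) / gegenbauerMass μ
  have hcongr : Set.EqOn (fun x => G (x ^ 2) * (s μ x * r μ x * D μ x y z))
      (fun x => K * (|-(x / (y * z))| • (fun u => G (y ^ 2 + z ^ 2 - 2 * y * z * u) *
        gegenbauerWeight μ u) (angleCos y z x))) (Set.Ioo |y - z| (y + z)) := fun x hx => by
    simp only [smul_eq_mul]
    rw [s_mul_r_mul_D_eq hμ hy hz hx, sq_add_sq_sub_angleCos hy hz]
    ring
  have hd : ∀ x ∈ Set.Ioo |y - z| (y + z), HasDerivWithinAt (angleCos y z) (-(x / (y * z)))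
      (Set.Ioo |y - z| (y + z)) x := fun x _ => (hasDerivAt_angleCos y z x).hasDerivWithinAt
  constructor
  · rw [intervalIntegrable_iff_integrableOn_Ioo_of_le (by norm_num), ← image_angleCos hy hz,
      integrableOn_image_iff_integrableOn_abs_deriv_smul measurableSet_Ioo hd
        (injOn_angleCos hy hz)] at hG
    refine IntegrableOn.of_forall_sdiff_eq_zero ?_ measurableSet_Ioi hzero
    exact IntegrableOn.congr_fun (hG.const_mul K) hcongr.symm measurableSet_Ioo
  · have hcv := integral_image_eq_integral_abs_deriv_smul measurableSet_Ioo hd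
      (injOn_angleCos hy hz) fun u => G (y ^ 2 + z ^ 2 - 2 * y * z * u) * gegenbauerWeight μ u
    rw [setIntegral_eq_of_subset_of_forall_sdiff_eq_zero measurableSet_Ioi hsub hzero,
      setIntegral_congr_fun measurableSet_Ioo hcongr, integral_const_mul,
      ← hcv, image_angleCos hy hz, intervalIntegral.integral_of_le (by norm_num),
      integral_Ioc_eq_integral_Ioo]

theorem integrableOn_s_mul_r_mul_D (hμ : -(1 / 2) < μ) {y z : ℝ} (hy : 0 < y) (hz : 0 < z) :
    IntegrableOn (fun x => s μ x * r μ x * D μ x y z) (Set.Ioi 0) := by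
  simpa using (integrableOn_and_integral_mul_D hμ hy hz (G := fun _ => 1)
    (by simpa using intervalIntegrable_gegenbauerWeight hμ)).1

theorem integral_s_mul_r_mul_D (hμ : -(1 / 2) < μ) {y z : ℝ} (hy : 0 < y) (hz : 0 < z) :
    ∫ x in Set.Ioi (0 : ℝ), s μ x * r μ x * D μ x y z = (s μ y * r μ y) * (s μ z * r μ z) := by
  have h := (integrableOn_and_integral_mul_D hμ hy hz (G := fun _ => 1)
    (by simpa using intervalIntegrable_gegenbauerWeight hμ)).2
  simp only [one_mul, integral_gegenbauerWeight hμ] at h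
  rw [h, div_mul_cancel₀ _ (gegenbauerMass_pos hμ).ne']

/-- The kernel `D` linearizes products of normalized Bessel functions. -/
theorem integral_normalizedBessel_mul_D (hμ : -(1 / 2) < μ) {y z : ℝ} (hy : 0 < y) (hz : 0 < z)
    (t : ℝ) :
    ∫ x in Set.Ioi (0 : ℝ), normalizedBessel μ ((t * x) ^ 2) * (s μ x * r μ x * D μ x y z) =
      (s μ y * r μ y * normalizedBessel μ ((t * y) ^ 2)) *
        (s μ z * r μ z * normalizedBessel μ ((t * z) ^ 2)) := by
  have hmem : ∀ u ∈ Set.Icc (-1 : ℝ) 1, 0 ≤ y ^ 2 + z ^ 2 - 2 * y * z * u := fun u hu => by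
    nlinarith [hu.2, mul_pos hy hz, sq_nonneg (y - z)]
  have hint : IntervalIntegrable (fun u => normalizedBessel μ
      (t ^ 2 * (y ^ 2 + z ^ 2 - 2 * y * z * u)) * gegenbauerWeight μ u) volume (-1) 1 := by
    have hw := intervalIntegrable_gegenbauerWeight hμ
    rw [intervalIntegrable_iff_integrableOn_Ioo_of_le (by norm_num)] at hw ⊢
    refine hw.bdd_mul (c := 1) ?_ ?_
    · exact ((measurable_normalizedBessel hμ).comp (by fun_prop)).aestronglyMeasurable
    · filter_upwards [ae_restrict_mem measurableSet_Ioo] with u hu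
      have h0 := hmem u (Set.Ioo_subset_Icc_self hu)
      -- The unit bound is available at squares only; the argument is nonnegative, hence the square
      -- of this number.
      have := abs_normalizedBessel_sq_le_one hμ (t * √(y ^ 2 + z ^ 2 - 2 * y * z * u))
      rwa [mul_pow, Real.sq_sqrt h0] at this
  have h := (integrableOn_and_integral_mul_D hμ hy hz
    (G := fun v => normalizedBessel μ (t ^ 2 * v)) hint).2
  have e : ∀ u : ℝ, t ^ 2 * (y ^ 2 + z ^ 2 - 2 * y * z * u) =
      (t * y) ^ 2 + (t * z) ^ 2 - 2 * (t * y) * (t * z) * u := fun u => by ring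
  simp only [e, integral_normalizedBessel_mul_gegenbauerWeight hμ, ← mul_pow] at h
  rw [h]
  have := (gegenbauerMass_pos hμ).ne'
  field_simp

end Kernel

end HankelConv

namespace HankelConv

open MeasureTheory

/-! ### Integrability of the convolution and factorization of its Hankel transform. -/

section Convolution

variable {μ : ℝ} {f g : ℝ → ℂ}

/-- The weight is measurable and positive on the half-line, so multiplying or dividing by it
preserves measurability. -/
theorem memL1_iff_integrable (hμ : -(1 / 2) < μ) :
    MemL1 (fun x => s μ x * r μ x) f ↔
      Integrable (fun x => ((s μ x * r μ x : ℝ) : ℂ) * f x) (volume.restrict (Set.Ioi 0)) := by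
  have hW : AEStronglyMeasurable (fun x => ((s μ x * r μ x : ℝ) : ℂ))
      (volume.restrict (Set.Ioi 0)) :=
    (Complex.measurable_ofReal.comp (measurable_s_mul_r μ)).aestronglyMeasurable
  have hW' : AEStronglyMeasurable (fun x => (((s μ x * r μ x)⁻¹ : ℝ) : ℂ))
      (volume.restrict (Set.Ioi 0)) :=
    (Complex.measurable_ofReal.comp (measurable_s_mul_r μ).inv).aestronglyMeasurable
  have hnorm : (fun x => ‖((s μ x * r μ x : ℝ) : ℂ) * f x‖) =ᵐ[volume.restrict (Set.Ioi 0)]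
      fun x => ‖f x‖ * (s μ x * r μ x) := by
    filter_upwards [ae_restrict_mem measurableSet_Ioi] with x hx
    rw [norm_mul, Complex.norm_real, Real.norm_of_nonneg (s_mul_r_pos hμ hx).le, mul_comm]
  constructor
  · rintro ⟨h1, h2⟩
    exact (integrable_norm_iff (hW.mul h1)).1 ((integrable_congr hnorm).2 h2)
  · intro h
    refine ⟨(hW'.mul h.aestronglyMeasurable).congr ?_, (integrable_congr hnorm).1 h.norm⟩
    filter_upwards [ae_restrict_mem measurableSet_Ioi] with x hx
    have := (s_mul_r_pos hμ hx).ne'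
    rw [Pi.mul_apply, ← mul_assoc, ← Complex.ofReal_mul, inv_mul_cancel₀ this, Complex.ofReal_one,
      one_mul]

theorem hankelIntegrand_eq (hμ : -(1 / 2) < μ) (f : ℝ → ℂ) {t y : ℝ} (ht : 0 < t) (hy : 0 < y) :
    hankelIntegrand μ f t y = ((t ^ (μ + 1 / 2) : ℝ) : ℂ) *
      ((normalizedBessel μ ((t * y) ^ 2) : ℂ) * (((s μ y * r μ y : ℝ) : ℂ) * f y)) := by
  have hty : 0 < t * y := by positivity
  have hg := Real.Gamma_pos_of_pos (show 0 < μ + 1 by linarith)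
  rw [hankelIntegrand, ← mul_assoc, ← mul_assoc, ← Complex.ofReal_mul, ← Complex.ofReal_mul,
    besselJ_eq hμ hty, s_mul_r_eq hy, c, Real.div_rpow hty.le (by norm_num)]
  congr 2
  have e : √(t * y) * (t * y) ^ μ = t ^ (μ + 1 / 2) * y ^ (μ + 1 / 2) := by
    rw [Real.sqrt_eq_rpow, ← Real.rpow_add hty, ← Real.mul_rpow ht.le hy.le, add_comm]
  have h2 : (0 : ℝ) < 2 ^ μ := by positivity
  calc √(t * y) * ((t * y) ^ μ / 2 ^ μ / Real.Gamma (μ + 1) * normalizedBessel μ ((t * y) ^ 2))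
      = (√(t * y) * (t * y) ^ μ) / (2 ^ μ * Real.Gamma (μ + 1)) *
        normalizedBessel μ ((t * y) ^ 2) := by field_simp
    _ = _ := by
      rw [e]
      ring

theorem integrable_normalizedBessel_mul (hμ : -(1 / 2) < μ) {α : Type*} [MeasurableSpace α]
    {ν : Measure α} {q : α → ℝ} (hq : Measurable q) {F : α → ℂ} (hF : Integrable F ν) :
    Integrable (fun x => (normalizedBessel μ (q x ^ 2) : ℂ) * F x) ν := by
  refine hF.bdd_mul (c := 1) ?_ (Filter.Eventually.of_forall fun x => ?_)
  · exact (Complex.measurable_ofReal.comp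
      ((measurable_normalizedBessel hμ).comp (hq.pow_const 2))).aestronglyMeasurable
  · rw [Complex.norm_real]
    exact abs_normalizedBessel_sq_le_one hμ _

theorem integrableOn_hankelIntegrand (hμ : -(1 / 2) < μ)
    (hf : MemL1 (fun x => s μ x * r μ x) f) {t : ℝ} (ht : 0 < t) :
    IntegrableOn (hankelIntegrand μ f t) (Set.Ioi 0) := by
  refine ((integrable_normalizedBessel_mul hμ (q := fun y => t * y) (by fun_prop)
    ((memL1_iff_integrable hμ).1 hf)).const_mul ((t ^ (μ + 1 / 2) : ℝ) : ℂ)).congr ?_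
  filter_upwards [ae_restrict_mem measurableSet_Ioi] with y hy
  exact (hankelIntegrand_eq hμ f ht hy).symm

theorem hankel_eq (hμ : -(1 / 2) < μ) (f : ℝ → ℂ) {t : ℝ} (ht : 0 < t) :
    hankel μ f t = ((t ^ (μ + 1 / 2) : ℝ) : ℂ) * ∫ y in Set.Ioi (0 : ℝ),
      (normalizedBessel μ ((t * y) ^ 2) : ℂ) * (((s μ y * r μ y : ℝ) : ℂ) * f y) := by
  rw [hankel, ← integral_const_mul]
  exact setIntegral_congr_fun measurableSet_Ioi fun y hy => hankelIntegrand_eq hμ f ht hy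

theorem ae_prod_restrict_Ioi : ∀ᵐ p : ℝ × ℝ ∂(volume.restrict (Set.Ioi (0 : ℝ))).prod
    (volume.restrict (Set.Ioi (0 : ℝ))), 0 < p.1 ∧ 0 < p.2 := by
  rw [Measure.prod_restrict]
  filter_upwards [ae_restrict_mem (measurableSet_Ioi.prod measurableSet_Ioi)] with p hp
  exact hp

/-- The weighted convolution integrand is integrable jointly in all three variables. -/
theorem integrable_weighted_convIntegrand (hμ : -(1 / 2) < μ)
    (hf : MemL1 (fun x => s μ x * r μ x) f) (hg : MemL1 (fun x => s μ x * r μ x) g) :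
    Integrable (fun q : (ℝ × ℝ) × ℝ =>
        ((s μ q.2 * r μ q.2 : ℝ) : ℂ) * convIntegrand μ f g q.2 q.1.1 q.1.2)
      (((volume.restrict (Set.Ioi 0)).prod (volume.restrict (Set.Ioi 0))).prod
        (volume.restrict (Set.Ioi 0))) := by
  have hmeas : AEStronglyMeasurable (fun q : (ℝ × ℝ) × ℝ =>
        ((s μ q.2 * r μ q.2 : ℝ) : ℂ) * convIntegrand μ f g q.2 q.1.1 q.1.2)
      (((volume.restrict (Set.Ioi 0)).prod (volume.restrict (Set.Ioi 0))).prod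
        (volume.restrict (Set.Ioi 0))) := by
    have hW : Measurable fun q : (ℝ × ℝ) × ℝ => ((s μ q.2 * r μ q.2 : ℝ) : ℂ) :=
      Complex.measurable_ofReal.comp ((measurable_s_mul_r μ).comp measurable_snd)
    have hD : Measurable fun q : (ℝ × ℝ) × ℝ => (D μ q.2 q.1.1 q.1.2 : ℂ) :=
      Complex.measurable_ofReal.comp
        ((measurable_D μ).comp (measurable_snd.prodMk measurable_fst))
    exact hW.aestronglyMeasurable.mul
      ((hD.aestronglyMeasurable.mul hf.1.comp_fst.comp_fst).mul hg.1.comp_snd.comp_fst)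
  have hsplit : ∀ x y z : ℝ, ((s μ x * r μ x : ℝ) : ℂ) * convIntegrand μ f g x y z =
      ((s μ x * r μ x * D μ x y z : ℝ) : ℂ) * (f y * g z) := fun x y z => by
    rw [convIntegrand]
    push_cast
    ring
  rw [integrable_prod_iff hmeas]
  constructor
  · filter_upwards [ae_prod_restrict_Ioi] with p hp
    simp only [hsplit]
    exact (Integrable.ofReal (integrableOn_s_mul_r_mul_D hμ hp.1 hp.2)).mul_const _
  -- By the mass of the kernel, the norms integrate over `x` to `‖f y‖ W(y) ‖g z‖ W(z)`, a product
  -- of two integrable functions.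
  · refine (hf.2.mul_prod hg.2).congr ?_
    filter_upwards [ae_prod_restrict_Ioi] with p hp
    have e : ∫ x in Set.Ioi (0 : ℝ),
          ‖((s μ x * r μ x : ℝ) : ℂ) * convIntegrand μ f g x p.1 p.2‖ =
        ∫ x in Set.Ioi (0 : ℝ), s μ x * r μ x * D μ x p.1 p.2 * (‖f p.1‖ * ‖g p.2‖) := by
      refine setIntegral_congr_fun measurableSet_Ioi fun x hx => ?_
      simp only [hsplit]
      rw [norm_mul, norm_mul, Complex.norm_real, Real.norm_of_nonneg
        (mul_nonneg (s_mul_r_pos hμ hx).le (D_nonneg hμ hx hp.1 hp.2))]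
    rw [e, integral_mul_const, integral_s_mul_r_mul_D hμ hp.1 hp.2]
    ring

theorem ae_integrableOn_convIntegrand (hμ : -(1 / 2) < μ)
    (hf : MemL1 (fun x => s μ x * r μ x) f) (hg : MemL1 (fun x => s μ x * r μ x) g) :
    ∀ᵐ x ∂(volume.restrict (Set.Ioi (0 : ℝ))),
      IntegrableOn (fun p : ℝ × ℝ => convIntegrand μ f g x p.1 p.2)
        (Set.Ioi 0 ×ˢ Set.Ioi 0) := by
  filter_upwards [(integrable_weighted_convIntegrand hμ hf hg).prod_left_ae,
    ae_restrict_mem measurableSet_Ioi] with x hx hx0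
  have hW : ((s μ x * r μ x : ℝ) : ℂ) ≠ 0 := Complex.ofReal_ne_zero.2 (s_mul_r_pos hμ hx0).ne'
  rw [Measure.prod_restrict] at hx
  exact (integrable_const_mul_iff hW.isUnit _).1 hx

/-- The iterated integral in `conv` is identified with the integral over the product where the
integrand is integrable, which is almost every `x`. -/
theorem ae_weight_mul_conv_eq (hμ : -(1 / 2) < μ)
    (hf : MemL1 (fun x => s μ x * r μ x) f) (hg : MemL1 (fun x => s μ x * r μ x) g) :
    ∀ᵐ x ∂(volume.restrict (Set.Ioi (0 : ℝ))),
      ((s μ x * r μ x : ℝ) : ℂ) * conv μ f g x =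
        ∫ p, ((s μ x * r μ x : ℝ) : ℂ) * convIntegrand μ f g x p.1 p.2
          ∂(volume.restrict (Set.Ioi (0 : ℝ))).prod (volume.restrict (Set.Ioi (0 : ℝ))) := by
  filter_upwards [ae_integrableOn_convIntegrand hμ hf hg] with x hx
  rw [IntegrableOn, Measure.volume_eq_prod, ← Measure.prod_restrict] at hx
  rw [integral_const_mul, conv, integral_prod_symm _ hx]

theorem memL1_conv (hμ : -(1 / 2) < μ)
    (hf : MemL1 (fun x => s μ x * r μ x) f) (hg : MemL1 (fun x => s μ x * r μ x) g) :
    MemL1 (fun x => s μ x * r μ x) (conv μ f g) := by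
  rw [memL1_iff_integrable hμ]
  refine (integrable_weighted_convIntegrand hμ hf hg).integral_prod_right.congr ?_
  filter_upwards [ae_weight_mul_conv_eq hμ hf hg] with x hx
  exact hx.symm

theorem hankel_conv (hμ : -(1 / 2) < μ)
    (hf : MemL1 (fun x => s μ x * r μ x) f) (hg : MemL1 (fun x => s μ x * r μ x) g)
    {t : ℝ} (ht : 0 < t) :
    hankel μ (conv μ f g) t = (r μ t : ℂ) * hankel μ f t * hankel μ g t := by
  set κ := volume.restrict (Set.Ioi (0 : ℝ))
  have hint := integrable_normalizedBessel_mul hμ (q := fun q : (ℝ × ℝ) × ℝ => t * q.2)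
    (by fun_prop) (integrable_weighted_convIntegrand hμ hf hg)
  have hinner : ∀ᵐ p ∂κ.prod κ, ∫ x, (normalizedBessel μ ((t * x) ^ 2) : ℂ) *
        (((s μ x * r μ x : ℝ) : ℂ) * convIntegrand μ f g x p.1 p.2) ∂κ =
      ((normalizedBessel μ ((t * p.1) ^ 2) : ℂ) * (((s μ p.1 * r μ p.1 : ℝ) : ℂ) * f p.1)) *
        ((normalizedBessel μ ((t * p.2) ^ 2) : ℂ) * (((s μ p.2 * r μ p.2 : ℝ) : ℂ) * g p.2)) := by
    filter_upwards [ae_prod_restrict_Ioi] with p hp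
    have e : ∀ x, (normalizedBessel μ ((t * x) ^ 2) : ℂ) *
        (((s μ x * r μ x : ℝ) : ℂ) * convIntegrand μ f g x p.1 p.2) =
        ((normalizedBessel μ ((t * x) ^ 2) * (s μ x * r μ x * D μ x p.1 p.2) : ℝ) : ℂ) *
          (f p.1 * g p.2) := fun x => by
      rw [convIntegrand]
      push_cast
      ring
    simp only [e]
    rw [integral_mul_const, integral_complex_ofReal,
      integral_normalizedBessel_mul_D hμ hp.1 hp.2]
    push_cast
    ring
  have key : ∫ x, (normalizedBessel μ ((t * x) ^ 2) : ℂ) *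
        (((s μ x * r μ x : ℝ) : ℂ) * conv μ f g x) ∂κ =
      (∫ y, (normalizedBessel μ ((t * y) ^ 2) : ℂ) * (((s μ y * r μ y : ℝ) : ℂ) * f y) ∂κ) *
        ∫ z, (normalizedBessel μ ((t * z) ^ 2) : ℂ) * (((s μ z * r μ z : ℝ) : ℂ) * g z) ∂κ := by
    -- The product of transforms is a double integral in `(y, z)`; linearization turns its integrand
    -- into an integral over `x`, and Fubini moves `x` outside.
    rw [← integral_prod_mul, ← integral_congr_ae hinner, integral_integral_swap hint]
    refine integral_congr_ae ?_
    filter_upwards [ae_weight_mul_conv_eq hμ hf hg] with x hx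
    rw [hx, ← integral_const_mul]
  -- The prefactor `t^(μ+1/2)` occurs once in the transform of the convolution and twice in the
  -- product; `r(t)` absorbs the surplus.
  have hr : (r μ t : ℂ) * ((t ^ (μ + 1 / 2) : ℝ) : ℂ) = 1 := by
    rw [r, ← Complex.ofReal_mul, ← Real.rpow_add ht,
      show -μ - 1 / 2 + (μ + 1 / 2) = 0 by ring, Real.rpow_zero, Complex.ofReal_one]
  rw [hankel_eq hμ _ ht, hankel_eq hμ _ ht, hankel_eq hμ _ ht, key]
  linear_combination (-((t ^ (μ + 1 / 2) : ℝ) : ℂ) *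
    ((∫ y, (normalizedBessel μ ((t * y) ^ 2) : ℂ) * (((s μ y * r μ y : ℝ) : ℂ) * f y) ∂κ) *
      ∫ z, (normalizedBessel μ ((t * z) ^ 2) : ℂ) * (((s μ z * r μ z : ℝ) : ℂ) * g z) ∂κ)) * hr

end Convolution

end HankelConv

theorem mainTheorem9 (μ : ℝ) (hμ : -(1 / 2) < μ) (f g : ℝ → ℂ)
    (hf : HankelConv.MemL1 (fun x => HankelConv.s μ x * HankelConv.r μ x) f)
    (hg : HankelConv.MemL1 (fun x => HankelConv.s μ x * HankelConv.r μ x) g) :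
    -- the double integral defining `f ♯ g` converges absolutely at almost every `x > 0`
    (∀ᵐ x ∂(MeasureTheory.volume.restrict (Set.Ioi (0 : ℝ))),
      MeasureTheory.IntegrableOn (fun p : ℝ × ℝ => HankelConv.convIntegrand μ f g x p.1 p.2)
        (Set.Ioi 0 ×ˢ Set.Ioi 0)) ∧
    -- `f ♯ g` is again in `L¹(sr)`
    HankelConv.MemL1 (fun x => HankelConv.s μ x * HankelConv.r μ x) (HankelConv.conv μ f g) ∧
    -- the three Hankel transforms converge absolutely, and the identity holds, at every `t > 0`
    ∀ t : ℝ, 0 < t →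
      MeasureTheory.IntegrableOn (HankelConv.hankelIntegrand μ f t) (Set.Ioi 0) ∧
      MeasureTheory.IntegrableOn (HankelConv.hankelIntegrand μ g t) (Set.Ioi 0) ∧
      MeasureTheory.IntegrableOn
        (HankelConv.hankelIntegrand μ (HankelConv.conv μ f g) t) (Set.Ioi 0) ∧
      HankelConv.hankel μ (HankelConv.conv μ f g) t =
        (HankelConv.r μ t : ℂ) * HankelConv.hankel μ f t * HankelConv.hankel μ g t := by
  have hc := HankelConv.memL1_conv hμ hf hg
  exact ⟨HankelConv.ae_integrableOn_convIntegrand hμ hf hg, hc, fun t ht =>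
    ⟨HankelConv.integrableOn_hankelIntegrand hμ hf ht,
      HankelConv.integrableOn_hankelIntegrand hμ hg ht,
      HankelConv.integrableOn_hankelIntegrand hμ hc ht, HankelConv.hankel_conv hμ hf hg ht⟩⟩
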